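/- Let $C,M\in\mathbb N$, $1\le p\le\infty$, $\tau>0$ and $B\in\mathbb R^{C\times M}$. The Schatten-$p$ norm $\|D\|_{S^p}$ of $D\in\mathbb R^{C\times M}$ is the $\ell^p$ norm of the vector of its $\min(C,M)$ singular values, and for a real function $f$ on a Euclidean space (matrices carry the Frobenius norm $\|\cdot\|_2$) $$\mathrm{prox}_{\tau f}(x)=\arg\min_y\Big\{\tfrac12\|y-x\|_2^2+\tau f(y)\Big\}.$$ Let $B=U\Sigma_0V^{\top}$ be a reduced singular value decomposition: $U\in\mathbb R^{C\times k}$ and $V\in\mathbb R^{M\times k}$ have orthonormal columns, and $\Sigma_0\in\mathbb R^{k\times k}$ is diagonal with nonnegative entries (in any order, zeros allowed). Then the minimizer defining $\mathrm{prox}_{\tau\|\cdot\|_p}(\mathrm{diag}(\Sigma_0))\in\mathbb R^k$ exists and is unique; let $\widehat\Sigma\in\mathbb R^{k\times k}$ be the diagonal matrix with this vector on its diagonal, and let $\Sigma_0^{\dagger}$ be the Moore–Penrose pseudo-inverse of $\Sigma_0$. The problem $$\min_{D\in\mathbb R^{C\times M}}\ \tfrac12\|D-B\|_2^2+\tau\|D\|_{S^p}$$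 has exactly one minimizer, and it is $$\mathrm{prox}_{\tau S^p}(B)=B\,V\,\widehat\Sigma\,\Sigma_0^{\dagger}\,V^{\top}.$$ -/

import Mathlib

open scoped Matrix ENNReal

-- `‖·‖` on real matrices is the Frobenius norm, the Euclidean norm of the array of entries.
attribute [local instance] Matrix.frobeniusNormedAddCommGroup

namespace SchattenProx

/-- The functional `y ↦ ½ ‖y - x‖² + τ f y` minimized by the proximity operator. -/
noncomputable def proxObjective {E : Type*} [NormedAddCommGroup E]
    (f : E → ℝ) (τ : ℝ) (x y : E) : ℝ :=
  1 / 2 * ‖y - x‖ ^ 2 + τ * f y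

/-- `z` is the one and only minimizer of `y ↦ ½ ‖y - x‖² + τ f y`. -/
def IsProx {E : Type*} [NormedAddCommGroup E] (f : E → ℝ) (τ : ℝ) (x z : E) : Prop :=
  (∀ y, proxObjective f τ x z ≤ proxObjective f τ x y) ∧
    ∀ w, (∀ y, proxObjective f τ x w ≤ proxObjective f τ x y) → w = z

/-- The proximity operator `prox_{τ f}(x) = argmin_y (½ ‖y - x‖² + τ f y)`
(an unspecified value if there is no minimizer). -/
noncomputable def prox {E : Type*} [NormedAddCommGroup E] (f : E → ℝ) (τ : ℝ) (x : E) : E :=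
  Classical.epsilon fun z => ∀ y, proxObjective f τ x z ≤ proxObjective f τ x y

theorem IsProx.prox_eq {E : Type*} [NormedAddCommGroup E] {f : E → ℝ} {τ : ℝ} {x z : E}
    (h : IsProx f τ x z) : prox f τ x = z :=
  h.2 _ (Classical.epsilon_spec
    (p := fun z => ∀ y, proxObjective f τ x z ≤ proxObjective f τ x y) ⟨z, h.1⟩)

/-- The `ℓ^p` norm, as a function on Euclidean space (whose own norm is the `ℓ²` norm);
for `p = ∞` it is the maximum of the absolute values. -/
noncomputable def lpNorm {k : ℕ} (p : ℝ≥0∞) (x : EuclideanSpace ℝ (Fin k)) : ℝ :=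
  ‖(WithLp.toLp p (fun i => x i) : PiLp p fun _ : Fin k => ℝ)‖

/-- The vector of the `min C M` singular values of a `C × M` matrix, in nonincreasing order. -/
noncomputable def singularValueVector {C M : ℕ} (D : Matrix (Fin C) (Fin M) ℝ) :
    EuclideanSpace ℝ (Fin (min C M)) :=
  WithLp.toLp 2 fun i => (Matrix.toEuclideanLin D).singularValues i

/-- The Schatten-`p` norm: the `ℓ^p` norm of the vector of singular values. -/
noncomputable def schattenNorm {C M : ℕ} (p : ℝ≥0∞) (D : Matrix (Fin C) (Fin M) ℝ) : ℝ :=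
  lpNorm p (singularValueVector D)

/-- `B = U S Vᵀ` is a (reduced) singular value decomposition with `k` singular values:
`U` and `V` have orthonormal columns, and `S` is `k × k`, diagonal, with nonnegative entries.
No order is imposed on the singular values, and some of them may be zero. -/
structure IsSVD {C M k : ℕ} (B : Matrix (Fin C) (Fin M) ℝ) (U : Matrix (Fin C) (Fin k) ℝ)
    (S : Matrix (Fin k) (Fin k) ℝ) (V : Matrix (Fin M) (Fin k) ℝ) : Prop where
  left_orthonormal : Uᵀ * U = 1
  right_orthonormal : Vᵀ * V = 1
  isDiag : S.IsDiag
  nonneg : ∀ i, 0 ≤ S i i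
  eq_mul : B = U * S * Vᵀ

/-- The four Penrose conditions: `X` is the Moore–Penrose pseudo-inverse of `A`. -/
structure IsPseudoInverse {m n : ℕ} (A : Matrix (Fin m) (Fin n) ℝ)
    (X : Matrix (Fin n) (Fin m) ℝ) : Prop where
  mul_mul_self : A * X * A = A
  mul_mul_inv : X * A * X = X
  symm_left : (A * X)ᵀ = A * X
  symm_right : (X * A)ᵀ = X * A

/-- The Moore–Penrose pseudo-inverse of a real matrix. -/
noncomputable def pinv {m n : ℕ} (A : Matrix (Fin m) (Fin n) ℝ) : Matrix (Fin n) (Fin m) ℝ :=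
  Classical.epsilon (IsPseudoInverse A)

theorem IsPseudoInverse.unique {m n : ℕ} {A : Matrix (Fin m) (Fin n) ℝ}
    {X Y : Matrix (Fin n) (Fin m) ℝ} (hX : IsPseudoInverse A X) (hY : IsPseudoInverse A Y) :
    X = Y := by
  have h1 : A * X = A * Y := by
    calc A * X = (A * X)ᵀ := hX.symm_left.symm
      _ = (A * Y * A * X)ᵀ := by rw [hY.mul_mul_self]
      _ = (A * X)ᵀ * (A * Y)ᵀ := by rw [← Matrix.transpose_mul, Matrix.mul_assoc (A * Y)]
      _ = A * X * (A * Y) := by rw [hX.symm_left, hY.symm_left]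
      _ = A * X * A * Y := by rw [← Matrix.mul_assoc]
      _ = A * Y := by rw [hX.mul_mul_self]
  have h2 : X * A = Y * A := by
    calc X * A = (X * A)ᵀ := hX.symm_right.symm
      _ = (X * (A * Y * A))ᵀ := by rw [hY.mul_mul_self]
      _ = (Y * A)ᵀ * (X * A)ᵀ := by rw [← Matrix.transpose_mul]; simp only [Matrix.mul_assoc]
      _ = Y * A * (X * A) := by rw [hX.symm_right, hY.symm_right]
      _ = Y * (A * X * A) := by simp only [Matrix.mul_assoc]
      _ = Y * A := by rw [hX.mul_mul_self]
  calc X = X * A * X := hX.mul_mul_inv.symm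
    _ = Y * (A * X) := by rw [h2, Matrix.mul_assoc]
    _ = Y * A * Y := by rw [h1, Matrix.mul_assoc]
    _ = Y := hY.mul_mul_inv

theorem IsPseudoInverse.pinv_eq {m n : ℕ} {A : Matrix (Fin m) (Fin n) ℝ}
    {X : Matrix (Fin n) (Fin m) ℝ} (hX : IsPseudoInverse A X) : pinv A = X :=
  (Classical.epsilon_spec (p := IsPseudoInverse A) ⟨X, hX⟩).unique hX

/-- For a diagonal matrix the pseudo-inverse inverts the nonzero diagonal entries
(recall `0⁻¹ = 0`). -/
theorem pinv_diagonal {k : ℕ} (d : Fin k → ℝ) :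
    pinv (Matrix.diagonal d) = Matrix.diagonal fun i => (d i)⁻¹ := by
  apply IsPseudoInverse.pinv_eq
  constructor <;> simp only [Matrix.diagonal_mul_diagonal, Matrix.diagonal_transpose,
    mul_inv_mul_cancel]
  congr 1
  funext i
  simpa using mul_inv_mul_cancel (d i)⁻¹

end SchattenProx

/-!
The matrix problem reduces to the vector problem by compressing to the singular vectors of `B`.
Let `B = U diag(s) Vᵀ`, and for a matrix `D` put `y = diag(Uᵀ D V)`. Then

* `‖D - B‖² = ‖D - U diag(y) Vᵀ‖² + ‖y - s‖²`, by Pythagoras (`sq_frobenius_norm_eq_add`);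
* `‖y‖_p ≤ ‖D‖_{S^p}`, by pinching (`lpNorm_diag_le_schattenNorm`).

Hence the matrix objective at `D` is at least the vector objective at `y` plus
`½ ‖D - U diag(y) Vᵀ‖²` (`proxObjective_diag_le`). Conversely `‖U diag(x) Vᵀ‖_{S^p} ≤ ‖x‖_p`
(`schattenNorm_mul_diagonal_mul_le`), so at `U diag(x) Vᵀ` the matrix objective is at most the
vector objective at `x`. If `σ` is the unique minimizer of the vector objective, then
`U diag(σ) Vᵀ` is a minimizer of the matrix objective, and any minimizer `D` has `y = σ` and
`D = U diag(y) Vᵀ`.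

Both norm inequalities come from one fact: if `D = ∑ⱼ tⱼ aⱼ bⱼᵀ` is a singular value decomposition,
the matrix `⟪uᵢ, aⱼ⟫ ⟪vᵢ, bⱼ⟫` is doubly substochastic by Bessel's inequality, and a doubly
substochastic matrix is an `ℓ^p` contraction by Jensen's inequality (`lpNorm_le_of_isBessel`). This
avoids von Neumann's trace inequality and any computation of the singular values of
`U diag(x) Vᵀ`.

The vector minimizer exists by coercivity and is unique by strong convexity
(`IsProx.of_convexOn`). It vanishes wherever `s` does (`IsProx.apply_eq_zero`), so
`B V diag(σ) S₀† Vᵀ = U S₀ diag(σ) S₀† Vᵀ` equals `U diag(σ) Vᵀ` even if some singular values of `B`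
are zero.
-/

open scoped RealInnerProductSpace

namespace SchattenProx

/-! ### The proximity operator of a convex function -/

theorem IsProx.of_convexOn {E : Type*} [NormedAddCommGroup E] [InnerProductSpace ℝ E]
    [FiniteDimensional ℝ E] {f : E → ℝ} (hcont : Continuous f) (hconv : ConvexOn ℝ Set.univ f)
    (hnonneg : ∀ y, 0 ≤ f y) {τ : ℝ} (hτ : 0 < τ) (x : E) :
    IsProx f τ x (prox f τ x) := by
  have hexists : ∃ z, ∀ y, proxObjective f τ x z ≤ proxObjective f τ x y := by
    refine Continuous.exists_forall_le (f := proxObjective f τ x) ?_ ?_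
    · unfold proxObjective
      fun_prop
    · have hnorm : Filter.Tendsto (fun y : E => ‖y - x‖) (Filter.cocompact E) Filter.atTop :=
        tendsto_norm_cocompact_atTop.comp (Homeomorph.subRight x).isClosedEmbedding.tendsto_cocompact
      have hsq := ((Filter.tendsto_pow_atTop two_ne_zero).comp hnorm).const_mul_atTop
        (by norm_num : (0 : ℝ) < 1 / 2)
      refine Filter.tendsto_atTop_mono (fun y => ?_) hsq
      simpa [proxObjective] using mul_nonneg hτ.le (hnonneg y)
  have hmin : ∀ y, proxObjective f τ x (prox f τ x) ≤ proxObjective f τ x y :=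
    Classical.epsilon_spec hexists
  refine ⟨hmin, fun w hw => ?_⟩
  generalize prox f τ x = z at hmin
  -- By the parallelogram law the midpoint beats two distinct minimizers by `‖w - z‖² / 8`.
  have hmid := hw ((1 / 2 : ℝ) • w + (1 / 2 : ℝ) • z)
  have hzw := hmin w
  have hwz := hw z
  have hf := hconv.2 (Set.mem_univ w) (Set.mem_univ z) (by norm_num : (0 : ℝ) ≤ 1 / 2)
    (by norm_num : (0 : ℝ) ≤ 1 / 2) (by norm_num)
  have hpar := parallelogram_law_with_norm ℝ (w - x) (z - x)
  have hdiff : w - x - (z - x) = w - z := by abel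
  have hhalf : (1 / 2 : ℝ) • w + (1 / 2 : ℝ) • z - x = (1 / 2 : ℝ) • (w - x + (z - x)) := by
    module
  have hhalf' : ‖(1 / 2 : ℝ) • (w - x + (z - x))‖ = 1 / 2 * ‖w - x + (z - x)‖ := by
    rw [norm_smul]; norm_num
  rw [hdiff] at hpar
  simp only [proxObjective, hhalf, hhalf', smul_eq_mul] at hmid hzw hwz hf
  have hτf := mul_le_mul_of_nonneg_left hf hτ.le
  have hzero : ‖w - z‖ ^ 2 ≤ 0 := by nlinarith
  rw [← sub_eq_zero, ← norm_eq_zero]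
  exact pow_eq_zero_iff two_ne_zero |>.1 (le_antisymm hzero (sq_nonneg _))

/-! ### The `ℓ^p` norm -/

theorem lpNorm_top {k : ℕ} (x : EuclideanSpace ℝ (Fin k)) : lpNorm ∞ x = ⨆ i, |x i| := by
  simp [lpNorm, PiLp.norm_eq_ciSup]

theorem lpNorm_eq_sum {k : ℕ} {p : ℝ≥0∞} (hp : 0 < p.toReal) (x : EuclideanSpace ℝ (Fin k)) :
    lpNorm p x = (∑ i, |x i| ^ p.toReal) ^ (1 / p.toReal) := by
  simp [lpNorm, PiLp.norm_eq_sum hp]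

theorem one_le_toReal {p : ℝ≥0∞} (hp : 1 ≤ p) (htop : p ≠ ∞) : 1 ≤ p.toReal := by
  simpa using ENNReal.toReal_mono htop hp

theorem lpNorm_congr_abs {k : ℕ} {p : ℝ≥0∞} (hp : 1 ≤ p) {x y : EuclideanSpace ℝ (Fin k)}
    (h : ∀ i, |x i| = |y i|) : lpNorm p x = lpNorm p y := by
  by_cases htop : p = ∞
  · subst htop
    simp only [lpNorm_top, h]
  · have hp' := zero_lt_one.trans_le (one_le_toReal hp htop)
    simp only [lpNorm_eq_sum hp', h]

theorem isProx_lpNorm {k : ℕ} {p : ℝ≥0∞} (hp : 1 ≤ p) {τ : ℝ} (hτ : 0 < τ)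
    (x : EuclideanSpace ℝ (Fin k)) : IsProx (lpNorm p) τ x (prox (lpNorm p) τ x) := by
  have : Fact (1 ≤ p) := ⟨hp⟩
  refine IsProx.of_convexOn ?_ ⟨convex_univ, fun y _ z _ a b ha hb _ => ?_⟩
    (fun y => norm_nonneg _) hτ x
  · exact continuous_norm.comp ((PiLp.continuous_toLp p _).comp (PiLp.continuous_ofLp 2 _))
  · refine (norm_add_le (a • (WithLp.toLp p (fun i => y i) : PiLp p fun _ : Fin k => ℝ))
      (b • WithLp.toLp p (fun i => z i))).trans ?_
    rw [norm_smul, norm_smul, Real.norm_of_nonneg ha, Real.norm_of_nonneg hb]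
    rfl

/-- Reflecting the `i`-th coordinate of the minimizer gives another minimizer when `x i = 0`, so
uniqueness makes that coordinate vanish. -/
theorem IsProx.apply_eq_zero {k : ℕ} {p : ℝ≥0∞} (hp : 1 ≤ p) {τ : ℝ}
    {x z : EuclideanSpace ℝ (Fin k)} (hz : IsProx (lpNorm p) τ x z) {i : Fin k} (hi : x i = 0) :
    z i = 0 := by
  let w : EuclideanSpace ℝ (Fin k) := WithLp.toLp 2 (Function.update (fun j => z j) i (-z i))
  have hw : ∀ j, w j = if j = i then -z i else z j := fun j => by
    simp [w, Function.update_apply]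
  have hobj : proxObjective (lpNorm p) τ x w = proxObjective (lpNorm p) τ x z := by
    have hlp : lpNorm p w = lpNorm p z := by
      refine lpNorm_congr_abs hp fun j => ?_
      rw [hw]
      split_ifs with h <;> simp [h]
    have hnorm : ‖w - x‖ ^ 2 = ‖z - x‖ ^ 2 := by
      rw [EuclideanSpace.real_norm_sq_eq, EuclideanSpace.real_norm_sq_eq]
      refine Finset.sum_congr rfl fun j _ => ?_
      rw [PiLp.sub_apply, PiLp.sub_apply, hw]
      split_ifs with h
      · subst h; rw [hi]; ring
      · rfl
    rw [proxObjective, proxObjective, hlp, hnorm]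
  have hwz := hz.2 w fun y => hobj ▸ hz.1 y
  have := hw i
  rw [hwz, if_pos rfl] at this
  linarith

/-- A doubly substochastic matrix is a contraction for every `ℓ^p` norm with `1 ≤ p`. -/
theorem lpNorm_le_of_substochastic {m n : ℕ} {p : ℝ≥0∞} (hp : 1 ≤ p) (W : Fin m → Fin n → ℝ)
    (hrow : ∀ i, ∑ j, |W i j| ≤ 1) (hcol : ∀ j, ∑ i, |W i j| ≤ 1)
    {x : EuclideanSpace ℝ (Fin n)} {y : EuclideanSpace ℝ (Fin m)}
    (hy : ∀ i, y i = ∑ j, W i j * x j) : lpNorm p y ≤ lpNorm p x := by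
  have habs : ∀ i, |y i| ≤ ∑ j, |W i j| * |x j| := fun i => by
    rw [hy]
    simpa only [abs_mul] using Finset.abs_sum_le_sum_abs (fun j => W i j * x j) Finset.univ
  by_cases htop : p = ∞
  · subst htop
    rw [lpNorm_top, lpNorm_top]
    have hsup : 0 ≤ ⨆ j, |x j| := Real.iSup_nonneg fun j => abs_nonneg _
    refine Real.iSup_le (fun i => ?_) hsup
    calc |y i| ≤ ∑ j, |W i j| * |x j| := habs i
      _ ≤ ∑ j, |W i j| * ⨆ j, |x j| := by
        gcongr with j
        exact le_ciSup (f := fun j => |x j|) (Set.finite_range _).bddAbove j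
      _ = (∑ j, |W i j|) * ⨆ j, |x j| := by rw [Finset.sum_mul]
      _ ≤ ⨆ j, |x j| := mul_le_of_le_one_left hsup (hrow i)
  · have h1 := one_le_toReal hp htop
    have h0 := zero_lt_one.trans_le h1
    rw [lpNorm_eq_sum h0, lpNorm_eq_sum h0]
    generalize p.toReal = q at h1 h0
    have hjensen : ∀ i, |y i| ^ q ≤ ∑ j, |W i j| * |x j| ^ q := fun i => by
      have hS : 0 ≤ ∑ j, |W i j| * |x j| ^ q := by positivity
      have hholder : |y i| ≤ (∑ j, |W i j| * |x j| ^ q) ^ q⁻¹ := by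
        refine (habs i).trans <| (Real.inner_le_weight_mul_Lp_of_nonneg Finset.univ h1 _ _
          (fun j => abs_nonneg _) (fun j => abs_nonneg _)).trans ?_
        refine mul_le_of_le_one_left (by positivity) (Real.rpow_le_one (by positivity) (hrow i) ?_)
        have := inv_le_one_of_one_le₀ h1
        linarith
      calc |y i| ^ q ≤ ((∑ j, |W i j| * |x j| ^ q) ^ q⁻¹) ^ q := by gcongr
        _ = ∑ j, |W i j| * |x j| ^ q := Real.rpow_inv_rpow hS h0.ne'
    gcongr
    calc ∑ i, |y i| ^ q ≤ ∑ i, ∑ j, |W i j| * |x j| ^ q := Finset.sum_le_sum fun i _ => hjensen i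
      _ = ∑ j, (∑ i, |W i j|) * |x j| ^ q := by
        rw [Finset.sum_comm]
        simp only [Finset.sum_mul]
      _ ≤ ∑ j, |x j| ^ q := Finset.sum_le_sum fun j _ =>
        mul_le_of_le_one_left (by positivity) (hcol j)

/-! ### Bessel families and singular vectors -/

/-- A finite family of vectors satisfying Bessel's inequality. Unlike an orthonormal family it may
contain zero vectors, which lets the left singular vectors with singular value `0` be taken as `0`
instead of being chosen by a completion argument. -/
def IsBessel {ι E : Type*} [Fintype ι] [NormedAddCommGroup E] [InnerProductSpace ℝ E]
    (v : ι → E) : Prop :=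
  ∀ x, ∑ i, ⟪v i, x⟫ ^ 2 ≤ ‖x‖ ^ 2

section Bessel

variable {ι E : Type*} [Fintype ι] [NormedAddCommGroup E] [InnerProductSpace ℝ E] {v : ι → E}

theorem IsBessel.of_orthogonal (hv : Pairwise fun i j => ⟪v i, v j⟫ = 0)
    (hnorm : ∀ i, ‖v i‖ ≤ 1) : IsBessel v := by
  classical
  intro x
  have hx : ⟪x, ∑ i, ⟪v i, x⟫ • v i⟫ = ∑ i, ⟪v i, x⟫ ^ 2 := by
    simp only [inner_sum, inner_smul_right, real_inner_comm x, sq]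
  have hself : ‖∑ i, ⟪v i, x⟫ • v i‖ ^ 2 ≤ ∑ i, ⟪v i, x⟫ ^ 2 := by
    rw [← real_inner_self_eq_norm_sq, sum_inner]
    refine Finset.sum_le_sum fun i _ => ?_
    rw [inner_sum, Finset.sum_eq_single i]
    · rw [real_inner_smul_left, real_inner_smul_right, real_inner_self_eq_norm_sq]
      have := pow_le_one₀ (n := 2) (norm_nonneg _) (hnorm i)
      nlinarith [sq_nonneg ⟪v i, x⟫]
    · intro j _ hj
      rw [real_inner_smul_left, real_inner_smul_right, hv hj.symm, mul_zero, mul_zero]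
    · simp
  have := norm_sub_sq_real x (∑ i, ⟪v i, x⟫ • v i)
  rw [hx] at this
  nlinarith [sq_nonneg ‖x - ∑ i, ⟪v i, x⟫ • v i‖]

theorem IsBessel.of_orthonormal (hv : Orthonormal ℝ v) : IsBessel v :=
  .of_orthogonal hv.2 fun i => (hv.1 i).le

theorem IsBessel.sq_norm_le_one (hv : IsBessel v) (i : ι) : ‖v i‖ ^ 2 ≤ 1 := by
  have h := (Finset.single_le_sum (f := fun j => ⟪v j, v i⟫ ^ 2) (fun j _ => sq_nonneg _)
    (Finset.mem_univ i)).trans (hv (v i))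
  rw [real_inner_self_eq_norm_sq] at h
  by_contra! hlt
  nlinarith

end Bessel

/-- Products of the coefficients of Bessel families form a doubly substochastic matrix, by the
inequality `|s t| ≤ (s² + t²) / 2`; this is its bound on the row sums, and exchanging the two pairs
of families gives the bound on the column sums. -/
theorem IsBessel.sum_abs_inner_mul_inner_le {ι κ E F : Type*} [Fintype ι] [Fintype κ]
    [NormedAddCommGroup E] [InnerProductSpace ℝ E] [NormedAddCommGroup F] [InnerProductSpace ℝ F]
    {a : ι → E} {b : ι → F} {u : κ → E} {v : κ → F} (ha : IsBessel a) (hb : IsBessel b)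
    (hu : IsBessel u) (hv : IsBessel v) (j : κ) :
    ∑ i, |⟪a i, u j⟫ * ⟪b i, v j⟫| ≤ 1 := by
  calc ∑ i, |⟪a i, u j⟫ * ⟪b i, v j⟫| ≤ ∑ i, 1 / 2 * (⟪a i, u j⟫ ^ 2 + ⟪b i, v j⟫ ^ 2) := by
        refine Finset.sum_le_sum fun i _ => ?_
        rw [abs_le]
        constructor <;> nlinarith [sq_nonneg (⟪a i, u j⟫ + ⟪b i, v j⟫),
          sq_nonneg (⟪a i, u j⟫ - ⟪b i, v j⟫)]
    _ = 1 / 2 * (∑ i, ⟪a i, u j⟫ ^ 2 + ∑ i, ⟪b i, v j⟫ ^ 2) := by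
        rw [← Finset.mul_sum, Finset.sum_add_distrib]
    _ ≤ 1 := by
        have := ha (u j)
        have := hb (v j)
        have := hu.sq_norm_le_one j
        have := hv.sq_norm_le_one j
        linarith

theorem lpNorm_le_of_isBessel {m n : ℕ} {E F : Type*} [NormedAddCommGroup E]
    [InnerProductSpace ℝ E] [NormedAddCommGroup F] [InnerProductSpace ℝ F] {p : ℝ≥0∞} (hp : 1 ≤ p)
    {a : Fin m → E} {b : Fin m → F} {u : Fin n → E} {v : Fin n → F} (ha : IsBessel a)
    (hb : IsBessel b) (hu : IsBessel u) (hv : IsBessel v)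
    {x : EuclideanSpace ℝ (Fin n)} {y : EuclideanSpace ℝ (Fin m)}
    (hy : ∀ i, y i = ∑ j, ⟪a i, u j⟫ * ⟪b i, v j⟫ * x j) : lpNorm p y ≤ lpNorm p x := by
  refine lpNorm_le_of_substochastic hp (fun i j => ⟪a i, u j⟫ * ⟪b i, v j⟫) (fun i => ?_)
    (ha.sum_abs_inner_mul_inner_le hb hu hv) hy
  simpa only [real_inner_comm] using hu.sum_abs_inner_mul_inner_le hv ha hb i

/-- Singular value decomposition with the `min C M` singular values of the Schatten norm. The left
vectors belonging to the singular value `0` are `0`, so that family is only Bessel. -/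
theorem exists_singularVectors {C M : ℕ} (D : Matrix (Fin C) (Fin M) ℝ) :
    ∃ (a : Fin (min C M) → EuclideanSpace ℝ (Fin C))
      (b : Fin (min C M) → EuclideanSpace ℝ (Fin M)),
      IsBessel a ∧ IsBessel b ∧
      (∀ j, singularValueVector D j = ⟪a j, Matrix.toEuclideanLin D (b j)⟫) ∧
      ∀ x, Matrix.toEuclideanLin D x = ∑ j, (singularValueVector D j * ⟪b j, x⟫) • a j := by
  set T := Matrix.toEuclideanLin D
  have hM : Module.finrank ℝ (EuclideanSpace ℝ (Fin M)) = M := by simp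
  let b := T.isSymmetric_adjoint_comp_self.eigenvectorBasis hM
  let s : Fin M → ℝ := fun j => T.singularValues j
  have hgram : ∀ i j, ⟪T (b i), T (b j)⟫ = if i = j then s j ^ 2 else 0 := fun i j => by
    have heig := T.isSymmetric_adjoint_comp_self.apply_eigenvectorBasis hM j
    rw [← LinearMap.adjoint_inner_right, ← LinearMap.comp_apply, heig, inner_smul_right,
      orthonormal_iff_ite.1 b.orthonormal, ← T.sq_singularValues_fin hM]
    simp [s]
  have hTb : ∀ j, s j = 0 → T (b j) = 0 := fun j hj => by
    rw [← inner_self_eq_zero (𝕜 := ℝ), hgram, if_pos rfl, hj, zero_pow two_ne_zero]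
  have hrank : ∀ j : Fin M, C ≤ j → s j = 0 := fun j hj =>
    T.singularValues_eq_zero_iff_le_finrank_range.2
      (((Submodule.finrank_le _).trans_eq (by simp)).trans hj)
  let e : Fin (min C M) → Fin M := Fin.castLE (min_le_right C M)
  have he : Function.Injective e := Fin.castLE_injective _
  have hs : ∀ j, singularValueVector D j = s (e j) := fun j => rfl
  refine ⟨fun j => (s (e j))⁻¹ • T (b (e j)), fun j => b (e j), ?_,
    .of_orthonormal (b.orthonormal.comp e he), fun j => ?_, fun x => ?_⟩
  · refine .of_orthogonal (fun i j hij => ?_) fun i => ?_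
    · beta_reduce
      rw [real_inner_smul_left, real_inner_smul_right, hgram, if_neg (he.ne hij), mul_zero,
        mul_zero]
    · refine (sq_le_one_iff₀ (norm_nonneg _)).1 ?_
      rw [← real_inner_self_eq_norm_sq, real_inner_smul_left, real_inner_smul_right, hgram,
        if_pos rfl]
      by_cases h : s (e i) = 0
      · simp [h]
      · exact le_of_eq (by field_simp)
  · rw [hs, real_inner_smul_left, hgram, if_pos rfl]
    by_cases h : s (e j) = 0
    · simp [h]
    · field_simp
  · have hterm : ∀ j, (singularValueVector D j * ⟪b (e j), x⟫) • (s (e j))⁻¹ • T (b (e j)) =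
        ⟪b (e j), x⟫ • T (b (e j)) := fun j => by
      rw [hs]
      by_cases h : s (e j) = 0
      · simp [hTb _ h]
      · rw [smul_smul]
        congr 1
        field_simp
    simp only [hterm]
    conv_lhs => rw [← b.sum_repr' x, map_sum]
    simp only [map_smul]
    refine (Fintype.sum_of_injective e he _ _ (fun j hj => ?_) fun j => rfl).symm
    rw [hTb j (hrank j ?_), smul_zero]
    by_contra! hlt
    exact hj ⟨⟨j, lt_min hlt j.2⟩, rfl⟩

/-! ### Compression to given singular vectors -/

section Compression

variable {C M k : ℕ} {p : ℝ≥0∞} {U : Matrix (Fin C) (Fin k) ℝ} {V : Matrix (Fin M) (Fin k) ℝ}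

theorem isBessel_col (hU : Uᵀ * U = 1) :
    IsBessel fun i => (WithLp.toLp 2 (U.col i) : EuclideanSpace ℝ (Fin C)) := by
  refine .of_orthonormal (orthonormal_iff_ite.2 fun i j => ?_)
  have := congrFun (congrFun hU i) j
  rw [Matrix.mul_apply, Matrix.one_apply] at this
  rw [← this, EuclideanSpace.inner_eq_star_dotProduct]
  simp [dotProduct, Matrix.col_apply, mul_comm]

theorem transpose_mul_mul_apply (D : Matrix (Fin C) (Fin M) ℝ) (i : Fin k) :
    (Uᵀ * D * V) i i =
      ⟪(WithLp.toLp 2 (U.col i) : EuclideanSpace ℝ (Fin C)),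
        Matrix.toEuclideanLin D (WithLp.toLp 2 (V.col i))⟫ := by
  rw [EuclideanSpace.inner_eq_star_dotProduct, Matrix.ofLp_toLpLin, Matrix.toLin'_apply, Matrix.mul_assoc,
    Matrix.mul_apply]
  simp [dotProduct, Matrix.mulVec, Matrix.mul_apply, mul_comm]

/-- Pinching: compressing a matrix to the diagonal in orthonormal frames does not increase the
Schatten norm. -/
theorem lpNorm_diag_le_schattenNorm (hp : 1 ≤ p) (hU : Uᵀ * U = 1) (hV : Vᵀ * V = 1)
    (D : Matrix (Fin C) (Fin M) ℝ) :
    lpNorm p (WithLp.toLp 2 (Uᵀ * D * V).diag) ≤ schattenNorm p D := by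
  obtain ⟨a, b, ha, hb, -, hD⟩ := exists_singularVectors D
  refine lpNorm_le_of_isBessel hp (isBessel_col hU) (isBessel_col hV) ha hb fun i => ?_
  simp only [Matrix.diag_apply, transpose_mul_mul_apply, hD, inner_sum, real_inner_smul_right]
  refine Finset.sum_congr rfl fun j _ => ?_
  rw [real_inner_comm (b j)]
  ring

/-- The singular values of `U diag(x) Vᵀ` arise from `x` by a doubly substochastic matrix, so they
need not be identified with the entries of `x`. -/
theorem schattenNorm_mul_diagonal_mul_le (hp : 1 ≤ p) (hU : Uᵀ * U = 1) (hV : Vᵀ * V = 1)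
    (x : EuclideanSpace ℝ (Fin k)) :
    schattenNorm p (U * Matrix.diagonal (fun i => x i) * Vᵀ) ≤ lpNorm p x := by
  obtain ⟨a, b, ha, hb, hs, -⟩ := exists_singularVectors (U * Matrix.diagonal (fun i => x i) * Vᵀ)
  refine lpNorm_le_of_isBessel hp ha hb (isBessel_col hU) (isBessel_col hV) fun j => ?_
  rw [hs, EuclideanSpace.inner_eq_star_dotProduct, Matrix.ofLp_toLpLin, Matrix.toLin'_apply,
    ← Matrix.mulVec_mulVec, ← Matrix.mulVec_mulVec, star_trivial, dotProduct_comm,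
    Matrix.dotProduct_mulVec]
  rw [dotProduct]
  simp only [Matrix.mulVec_diagonal]
  simp only [dotProduct, Matrix.mulVec, Matrix.vecMul,
    EuclideanSpace.inner_eq_star_dotProduct, Matrix.transpose_apply, star_trivial,
    Matrix.col_apply]
  refine Finset.sum_congr rfl fun i _ => ?_
  simp only [mul_comm]
  ring

theorem sq_frobenius_norm_eq_trace (A : Matrix (Fin C) (Fin M) ℝ) :
    ‖A‖ ^ 2 = (Aᵀ * A).trace := by
  rw [Matrix.frobenius_norm_def, ← Real.sqrt_eq_rpow, Real.sq_sqrt (by positivity),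
    Finset.sum_comm]
  simp [Matrix.trace, Matrix.mul_apply, sq]

/-- Pythagoras for the projection of `R` onto the span of the rank-one matrices `uᵢ vᵢᵀ`. -/
theorem sq_frobenius_norm_eq_add (hU : Uᵀ * U = 1) (hV : Vᵀ * V = 1)
    (R : Matrix (Fin C) (Fin M) ℝ) :
    ‖R‖ ^ 2 = ‖R - U * Matrix.diagonal (Uᵀ * R * V).diag * Vᵀ‖ ^ 2 +
      ‖(WithLp.toLp 2 (Uᵀ * R * V).diag : EuclideanSpace ℝ (Fin k))‖ ^ 2 := by
  set z := (Uᵀ * R * V).diag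
  have hcross : (Rᵀ * (U * Matrix.diagonal z * Vᵀ)).trace = ∑ i, z i ^ 2 := by
    rw [← Matrix.mul_assoc, Matrix.trace_mul_comm, ← Matrix.mul_assoc, ← Matrix.mul_assoc,
      Matrix.trace]
    refine Finset.sum_congr rfl fun i _ => ?_
    have hz : (Vᵀ * Rᵀ * U) i i = z i := by
      calc _ = (Vᵀ * Rᵀ * U)ᵀ i i := rfl
        _ = z i := by
          rw [Matrix.transpose_mul, Matrix.transpose_mul, Matrix.transpose_transpose,
            Matrix.transpose_transpose, ← Matrix.mul_assoc]
          rfl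
    rw [Matrix.diag_apply, Matrix.mul_diagonal, hz, sq]
  have hself : ((U * Matrix.diagonal z * Vᵀ)ᵀ * (U * Matrix.diagonal z * Vᵀ)).trace =
      ∑ i, z i ^ 2 := by
    have : (U * Matrix.diagonal z * Vᵀ)ᵀ * (U * Matrix.diagonal z * Vᵀ) =
        V * (Matrix.diagonal z * Matrix.diagonal z * Vᵀ) := by
      calc _ = V * (Matrix.diagonal z * ((Uᵀ * U) * (Matrix.diagonal z * Vᵀ))) := by
            simp only [Matrix.transpose_mul, Matrix.transpose_transpose,
              Matrix.diagonal_transpose, Matrix.mul_assoc]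
        _ = _ := by rw [hU, Matrix.one_mul, Matrix.mul_assoc]
    rw [this, Matrix.trace_mul_comm, Matrix.mul_assoc, hV, Matrix.mul_one,
      Matrix.diagonal_mul_diagonal, Matrix.trace_diagonal]
    simp only [sq]
  have hcross' : ((U * Matrix.diagonal z * Vᵀ)ᵀ * R).trace = ∑ i, z i ^ 2 := by
    rw [← hcross, ← Matrix.trace_transpose, Matrix.transpose_mul, Matrix.transpose_transpose]
  rw [sq_frobenius_norm_eq_trace, sq_frobenius_norm_eq_trace, EuclideanSpace.real_norm_sq_eq,
    Matrix.transpose_sub, Matrix.sub_mul, Matrix.mul_sub, Matrix.mul_sub, Matrix.trace_sub,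
    Matrix.trace_sub, Matrix.trace_sub, hcross, hcross', hself]
  ring

variable {B : Matrix (Fin C) (Fin M) ℝ} {s : Fin k → ℝ} {τ : ℝ}

theorem diagonal_sub_eq (x y : Fin k → ℝ) :
    Matrix.diagonal (x - y) = Matrix.diagonal x - Matrix.diagonal y :=
  (Matrix.diagonal_sub x y).symm

theorem transpose_mul_mul_diagonal_mul (hU : Uᵀ * U = 1) (hV : Vᵀ * V = 1) (x : Fin k → ℝ) :
    Uᵀ * (U * Matrix.diagonal x * Vᵀ) * V = Matrix.diagonal x := by
  calc _ = (Uᵀ * U) * Matrix.diagonal x * (Vᵀ * V) := by simp only [Matrix.mul_assoc]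
    _ = _ := by rw [hU, hV, Matrix.one_mul, Matrix.mul_one]

/-- The matrix objective dominates the vector objective at the compressed diagonal, with a gap that
measures the distance to the matrices diagonal in the given frames. -/
theorem proxObjective_diag_le (hp : 1 ≤ p) (hτ : 0 < τ) (hU : Uᵀ * U = 1) (hV : Vᵀ * V = 1)
    (hB : B = U * Matrix.diagonal s * Vᵀ) (D : Matrix (Fin C) (Fin M) ℝ) :
    1 / 2 * ‖D - U * Matrix.diagonal (Uᵀ * D * V).diag * Vᵀ‖ ^ 2 +
      proxObjective (lpNorm p) τ (WithLp.toLp 2 s) (WithLp.toLp 2 (Uᵀ * D * V).diag) ≤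
    proxObjective (schattenNorm p) τ B D := by
  have hdiag : (Uᵀ * (D - B) * V).diag = (Uᵀ * D * V).diag - s := by
    rw [hB, Matrix.mul_sub, Matrix.sub_mul, transpose_mul_mul_diagonal_mul hU hV,
      Matrix.diag_sub, Matrix.diag_diagonal]
  have hpyth := sq_frobenius_norm_eq_add hU hV (D - B)
  have hres : D - B - U * Matrix.diagonal ((Uᵀ * D * V).diag - s) * Vᵀ =
      D - U * Matrix.diagonal (Uᵀ * D * V).diag * Vᵀ := by
    rw [diagonal_sub_eq, Matrix.mul_sub, Matrix.sub_mul, hB]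
    abel
  rw [hdiag, hres, WithLp.toLp_sub] at hpyth
  have hnorm := mul_le_mul_of_nonneg_left (lpNorm_diag_le_schattenNorm hp hU hV D) hτ.le
  rw [proxObjective, proxObjective, hpyth]
  linarith

theorem proxObjective_mul_diagonal_mul_le (hp : 1 ≤ p) (hτ : 0 < τ) (hU : Uᵀ * U = 1)
    (hV : Vᵀ * V = 1) (hB : B = U * Matrix.diagonal s * Vᵀ) (x : EuclideanSpace ℝ (Fin k)) :
    proxObjective (schattenNorm p) τ B (U * Matrix.diagonal (fun i => x i) * Vᵀ) ≤
      proxObjective (lpNorm p) τ (WithLp.toLp 2 s) x := by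
  have hsub : U * Matrix.diagonal (fun i => x i) * Vᵀ - B =
      U * Matrix.diagonal ((fun i => x i) - s) * Vᵀ := by
    rw [hB, diagonal_sub_eq, Matrix.mul_sub, Matrix.sub_mul]
  have hpyth := sq_frobenius_norm_eq_add hU hV (U * Matrix.diagonal ((fun i => x i) - s) * Vᵀ)
  rw [transpose_mul_mul_diagonal_mul hU hV, Matrix.diag_diagonal, sub_self, norm_zero] at hpyth
  have hx : (WithLp.toLp 2 ((fun i => x i) - s) : EuclideanSpace ℝ (Fin k)) =
      x - WithLp.toLp 2 s := rfl
  rw [hx] at hpyth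
  have hnorm := mul_le_mul_of_nonneg_left (schattenNorm_mul_diagonal_mul_le hp hU hV x) hτ.le
  rw [proxObjective, proxObjective, hsub, hpyth]
  linarith

theorem IsProx.schattenNorm (hp : 1 ≤ p) (hτ : 0 < τ) (hU : Uᵀ * U = 1) (hV : Vᵀ * V = 1)
    (hB : B = U * Matrix.diagonal s * Vᵀ) {σ : EuclideanSpace ℝ (Fin k)}
    (hσ : IsProx (lpNorm p) τ (WithLp.toLp 2 s) σ) :
    IsProx (schattenNorm p) τ B (U * Matrix.diagonal (fun i => σ i) * Vᵀ) := by
  have hupper := proxObjective_mul_diagonal_mul_le hp hτ hU hV hB σ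
  refine ⟨fun D => ?_, fun D hD => ?_⟩
  · have hlower := proxObjective_diag_le hp hτ hU hV hB D
    have hvec := hσ.1 (WithLp.toLp 2 (Uᵀ * D * V).diag)
    have := sq_nonneg ‖D - U * Matrix.diagonal (Uᵀ * D * V).diag * Vᵀ‖
    linarith
  · have hlower := (proxObjective_diag_le hp hτ hU hV hB D).trans ((hD _).trans hupper)
    have hvec := hσ.1 (WithLp.toLp 2 (Uᵀ * D * V).diag)
    have hgap := sq_nonneg ‖D - U * Matrix.diagonal (Uᵀ * D * V).diag * Vᵀ‖
    have hdiag : WithLp.toLp 2 (Uᵀ * D * V).diag = σ :=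
      hσ.2 _ fun y => le_trans (by linarith) (hσ.1 y)
    have hzero : ‖D - U * Matrix.diagonal (Uᵀ * D * V).diag * Vᵀ‖ ^ 2 = 0 :=
      le_antisymm (by linarith) hgap
    rw [← hdiag]
    exact sub_eq_zero.1 (norm_eq_zero.1 (pow_eq_zero_iff two_ne_zero |>.1 hzero))

end Compression

end SchattenProx

theorem proposition5p3 {C M k : ℕ} (p : ℝ≥0∞) (hp : 1 ≤ p) (τ : ℝ) (hτ : 0 < τ)
    (B : Matrix (Fin C) (Fin M) ℝ)
    (U : Matrix (Fin C) (Fin k) ℝ) (S₀ : Matrix (Fin k) (Fin k) ℝ)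
    (V : Matrix (Fin M) (Fin k) ℝ) (hB : SchattenProx.IsSVD B U S₀ V)
    (σhat : EuclideanSpace ℝ (Fin k))
    (hσhat : σhat = SchattenProx.prox (SchattenProx.lpNorm p) τ (WithLp.toLp 2 S₀.diag)) :
    SchattenProx.IsProx (SchattenProx.lpNorm p) τ (WithLp.toLp 2 S₀.diag) σhat ∧
    SchattenProx.IsProx (SchattenProx.schattenNorm p) τ B
      (B * V * Matrix.diagonal (fun i => σhat i) * SchattenProx.pinv S₀ * Vᵀ) ∧
    SchattenProx.prox (SchattenProx.schattenNorm p) τ B =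
      B * V * Matrix.diagonal (fun i => σhat i) * SchattenProx.pinv S₀ * Vᵀ := by
  have hσ : SchattenProx.IsProx (SchattenProx.lpNorm p) τ (WithLp.toLp 2 S₀.diag) σhat :=
    hσhat ▸ SchattenProx.isProx_lpNorm hp hτ _
  have hS : Matrix.diagonal S₀.diag = S₀ := hB.isDiag.diagonal_diag
  have hpinv : SchattenProx.pinv S₀ = Matrix.diagonal fun i => (S₀ i i)⁻¹ := by
    conv_lhs => rw [← hS]
    exact SchattenProx.pinv_diagonal _
  have hformula : B * V * Matrix.diagonal (fun i => σhat i) * SchattenProx.pinv S₀ * Vᵀ =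
      U * Matrix.diagonal (fun i => σhat i) * Vᵀ := by
    -- Where `S₀ i i = 0`, the factor `S₀ i i * (S₀ i i)⁻¹` is `0`, but so is `σhat i`.
    have hdiag : S₀ * Matrix.diagonal (fun i => σhat i) * SchattenProx.pinv S₀ =
        Matrix.diagonal fun i => σhat i := by
      rw [hpinv]
      nth_rewrite 1 [← hS]
      rw [Matrix.diagonal_mul_diagonal, Matrix.diagonal_mul_diagonal]
      congr 1
      funext i
      by_cases hi : S₀ i i = 0
      · have : σhat i = 0 := hσ.apply_eq_zero hp hi
        simp [this]
      · simp only [Matrix.diag_apply]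
        field_simp
    calc _ = U * (S₀ * (Vᵀ * V) * Matrix.diagonal (fun i => σhat i) *
            SchattenProx.pinv S₀) * Vᵀ := by
          rw [hB.eq_mul]
          simp only [Matrix.mul_assoc]
      _ = _ := by rw [hB.right_orthonormal, Matrix.mul_one, hdiag]
  have hprox := hσ.schattenNorm hp hτ hB.left_orthonormal hB.right_orthonormal
    (hB.eq_mul.trans (by rw [hS]))
  rw [hformula]
  exact ⟨hσ, hprox, hprox.prox_eq⟩
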